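/- Let $R$ be a commutative Noetherian ring with non-zero identity, $I$ a proper ideal of $R$, $M$ a finitely generated $R$-module and $N$ an arbitrary $R$-module. For $i\ge 0$ let $$H^i_I(M,N)=\varinjlim_q \operatorname{Ext}^i_R(M/I^qM,N),\qquad H^i_I(N)=H^i_I(R,N),$$ where the direct system is induced by the natural maps $M/I^{q+1}M\to M/I^qM$. Put $$\operatorname{depth}_I(M,N)=\inf\{i\ge 0: H^i_I(M,N)\ne 0\},\qquad \operatorname{cd}_I(M,N)=\sup\{i\ge 0: H^i_I(M,N)\ne 0\},$$ $$\operatorname{depth}_I N=\inf\{i\ge 0: H^i_I(N)\ne 0\},\qquad \operatorname{cd}_I N=\sup\{i\ge 0: H^i_I(N)\ne 0\},$$ $$h_I(M,N)=\sup_{q\ge 0}\,\sup\{i\ge 0: \operatorname{Ext}^i_R(M,H^q_I(N))\ne 0\},$$ with the conventions $\inf\emptyset=+\infty$, $\sup\emptyset=-\infty$ and $(-\infty)+x=x+(-\infty)=-\infty$ for every $x$ (including $x=+\infty$). Then: (i) $\operatorname{depth}_I N\le \operatorname{depth}_I(M,N)$ and $\operatorname{cd}_I(M,N)\le \operatorname{cd}_I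 N+h_I(M,N)$; moreover, if $H^i_I(M,N)\neq 0$ for some $i\ge 0$, then $\operatorname{depth}_I(M,N)\le\operatorname{cd}_I(M,N)$, so that $$\operatorname{depth}_I N\le \operatorname{depth}_I(M,N)\le\operatorname{cd}_I(M,N)\le \operatorname{cd}_I N+h_I(M,N).$$ (ii) If $\operatorname{cd}_I N$ and $h_I(M,N)$ are both (finite) non-negative integers, there is an isomorphism of $R$-modules $$\operatorname{Ext}^{h_I(M,N)}_R\bigl(M,H^{\operatorname{cd}_I N}_I(N)\bigr)\cong H^{\operatorname{cd}_I N+h_I(M,N)}_I(M,N).$$ (iii) If $\operatorname{depth}_I N$ is finite, and either $\operatorname{depth}_I N=0$ or $\operatorname{depth}_I N\ge\max\{1,h_I(M,N)\}$, there is an isomorphism of $R$-modules $$H^{\operatorname{depth}_I N}_I(M,N)\cong \operatorname{Hom}_R\bigl(M,H^{\operatorname{depth}_I N}_I(N)\bigr).$$ -/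

import Mathlib

universe u

noncomputable section

namespace GenLC

/-- The module `Ext^i_R(M, N)`: Mathlib's `Ext` in the category of `R`-modules. -/
abbrev ExtMod (R : Type u) [CommRing R] (M N : Type u) [AddCommGroup M] [Module R M]
    [AddCommGroup N] [Module R N] (i : ℕ) : Type u :=
  CategoryTheory.Abelian.Ext (ModuleCat.of R M) (ModuleCat.of R N) i

/-- The `R`-linear map `Ext^i_R(M', N) → Ext^i_R(M, N)` induced by `f : M → M'`. -/
def extPrecomp {R : Type u} [CommRing R] {M M' : Type u} [AddCommGroup M] [Module R M]
    [AddCommGroup M'] [Module R M'] (f : M →ₗ[R] M') (N : Type u) [AddCommGroup N] [Module R N]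
    (i : ℕ) : ExtMod R M' N i →ₗ[R] ExtMod R M N i :=
  (CategoryTheory.Abelian.Ext.mk₀ (ModuleCat.ofHom f)).precompOfLinear R (ModuleCat.of R N)
    (zero_add i)

variable {R : Type u} [CommRing R] (I : Ideal R)
  (M : Type u) [AddCommGroup M] [Module R M] (N : Type u) [AddCommGroup N] [Module R N]

/-- The generalized local cohomology module `H^i_I(M, N)`: the direct limit over `q` of the modules
`Ext^i_R(M / I^q M, N)`, whose transition maps are induced by the natural projections
`M / I^n M → M / I^m M` for `m ≤ n` (`Submodule.factorPow`). -/
abbrev genLocalCohomology (i : ℕ) : Type u :=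
  Module.DirectLimit (fun q : ℕ => ExtMod R (M ⧸ (I ^ q • ⊤ : Submodule R M)) N i)
    (fun _ _ h => extPrecomp (Submodule.factorPow I M h) N i)

/-- The local cohomology module `H^i_I(N)`, i.e. `H^i_I(R, N)`, the direct limit over `q`
of `Ext^i_R(R / I^q, N)`. -/
abbrev localCohomology (i : ℕ) : Type u := genLocalCohomology I R N i

/-- `depth_I(M, N) = inf {i ≥ 0 | H^i_I(M, N) ≠ 0}`, with `inf ∅ = ∞`. -/
def pairDepth : ℕ∞ :=
  ⨅ (i : ℕ) (_ : Nontrivial (genLocalCohomology I M N i)), (i : ℕ∞)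

/-- `cd_I(M, N) = sup {i ≥ 0 | H^i_I(M, N) ≠ 0}`, with `sup ∅ = -∞` (the element `⊥`). -/
def pairCd : WithBot ℕ∞ :=
  ⨆ (i : ℕ) (_ : Nontrivial (genLocalCohomology I M N i)), ((i : ℕ∞) : WithBot ℕ∞)

/-- `depth_I N = inf {i ≥ 0 | H^i_I(N) ≠ 0}`, with `inf ∅ = ∞`. -/
def depth : ℕ∞ :=
  ⨅ (i : ℕ) (_ : Nontrivial (localCohomology I N i)), (i : ℕ∞)

/-- `cd_I N = sup {i ≥ 0 | H^i_I(N) ≠ 0}`, with `sup ∅ = -∞`. -/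
def cd : WithBot ℕ∞ :=
  ⨆ (i : ℕ) (_ : Nontrivial (localCohomology I N i)), ((i : ℕ∞) : WithBot ℕ∞)

/-- `e_R(M, N) = sup {i ≥ 0 | Ext^i_R(M, N) ≠ 0}`, with `sup ∅ = -∞`. -/
def extSup (R : Type u) [CommRing R] (M N : Type u) [AddCommGroup M] [Module R M]
    [AddCommGroup N] [Module R N] : WithBot ℕ∞ :=
  ⨆ (i : ℕ) (_ : Nontrivial (ExtMod R M N i)), ((i : ℕ∞) : WithBot ℕ∞)

/-- `h_I(M, N) = sup_{q ≥ 0} e_R(M, H^q_I(N))`. -/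
def hInv : WithBot ℕ∞ :=
  ⨆ q : ℕ, extSup R M (localCohomology I N q)

end GenLC

end

/-! The conceptual source is the spectral sequence `Ext^p(M, H^q_I(N)) ⇒ H^{p+q}_I(M, N)`: the
bounds and the two isomorphisms are its vanishing, corner and edge statements. The proof replaces it
by induction on degree, with dimension shifting in `N`.

Embed `N` in an injective `E` with cokernel `C`. Then `H^{i+1}_I(M, C) ≅ H^{i+2}_I(M, N)`, and
likewise with `R` for `M` (`genLCShift`). What the shift misses is the passage from `H^0` of `C` to
`H^1` of `N`. There `H^0_I(M, -) = Hom(M, Γ_I(-))` for finite `M`, and `Γ_I(E)` is again injective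
by Artin–Rees (`powTorsion_injective`). With `B` the image of `Γ_I(E) → Γ_I(C)`, there are two short
exact sequences, 0 → Γ_I(N) → Γ_I(E) → B → 0 and 0 → B → Γ_I(C) → H^1_I(N) → 0. The first gives
`Ext^{i+1}(M, B) ≅ Ext^{i+2}(M, Γ_I(N))`; the second then relates the Ext modules of `Γ_I(C)` to
those of `H^1_I(N)`. Moreover `H^1_I(M, N)` is the cokernel of `Hom(M, Γ_I(E)) → Hom(M, Γ_I(C))`,
which settles degree one.

Three inductions carry the theorem: `genLocalCohomology_subsingleton` for the inequalities,
`nonempty_ext_equiv_genLocalCohomology` for the top degree, `nonempty_genLocalCohomology_equiv_hom`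
for the lowest. -/

namespace GenLC

open CategoryTheory CategoryTheory.Abelian

/-! ### Functoriality and long exact sequences of Ext, in linear-map form -/

section ExtLayer

variable {R : Type u} [CommRing R]
  {A : Type u} [AddCommGroup A] [Module R A] {B : Type u} [AddCommGroup B] [Module R B]
  {C : Type u} [AddCommGroup C] [Module R C]

/-- The `R`-linear map `Ext^i_R(X, A) → Ext^i_R(X, B)` induced by `f : A → B`. -/
noncomputable def extPostcomp (X : Type u) [AddCommGroup X] [Module R X] (f : A →ₗ[R] B) (i : ℕ) :
    ExtMod R X A i →ₗ[R] ExtMod R X B i :=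
  (Ext.mk₀ (ModuleCat.ofHom f)).postcompOfLinear R (ModuleCat.of R X) (add_zero i)

/-- The short complex of modules `A → B → C`. -/
abbrev sesComplex (f : A →ₗ[R] B) (g : B →ₗ[R] C) (hfg : Function.Exact f g) :
    ShortComplex (ModuleCat.{u} R) :=
  ShortComplex.mk (ModuleCat.ofHom f) (ModuleCat.ofHom g)
    (by rw [← ModuleCat.ofHom_comp, hfg.linearMap_comp_eq_zero]; rfl)

lemma sesComplex_shortExact {f : A →ₗ[R] B} {g : B →ₗ[R] C} (hf : Function.Injective f)
    (hfg : Function.Exact f g) (hg : Function.Surjective g) :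
    (sesComplex f g hfg).ShortExact :=
  ModuleCat.shortComplex_shortExact _ hfg hf hg

/-- The connecting map `Ext^i_R(X, C) → Ext^{i+1}_R(X, A)` of a short exact sequence. -/
noncomputable def extδ (X : Type u) [AddCommGroup X] [Module R X] {f : A →ₗ[R] B} {g : B →ₗ[R] C}
    (hf : Function.Injective f) (hfg : Function.Exact f g) (hg : Function.Surjective g) (i : ℕ) :
    ExtMod R X C i →ₗ[R] ExtMod R X A (i + 1) :=
  (sesComplex_shortExact hf hfg hg).extClass.postcompOfLinear R (ModuleCat.of R X) rfl

variable (X : Type u) [AddCommGroup X] [Module R X]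

lemma extPrecomp_apply {Y : Type u} [AddCommGroup Y] [Module R Y] (u : X →ₗ[R] Y) (i : ℕ)
    (x : ExtMod R Y A i) :
    extPrecomp u A i x = (Ext.mk₀ (ModuleCat.ofHom u)).comp x (zero_add i) := rfl

lemma extPostcomp_apply (f : A →ₗ[R] B) (i : ℕ) (x : ExtMod R X A i) :
    extPostcomp X f i x = x.comp (Ext.mk₀ (ModuleCat.ofHom f)) (add_zero i) := rfl

lemma extδ_apply {f : A →ₗ[R] B} {g : B →ₗ[R] C}
    (hf : Function.Injective f) (hfg : Function.Exact f g) (hg : Function.Surjective g) (i : ℕ)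
    (x : ExtMod R X C i) :
    extδ X hf hfg hg i x = x.comp (sesComplex_shortExact hf hfg hg).extClass rfl := rfl

lemma extPostcomp_comp (f : A →ₗ[R] B) (g : B →ₗ[R] C) (i : ℕ) :
    extPostcomp X g i ∘ₗ extPostcomp X f i = extPostcomp X (g ∘ₗ f) i := by
  ext x
  rw [LinearMap.comp_apply, extPostcomp_apply, extPostcomp_apply, extPostcomp_apply, Ext.comp_assoc_of_third_deg_zero, Ext.mk₀_comp_mk₀, ModuleCat.ofHom_comp]

lemma extPostcomp_id (i : ℕ) :
    extPostcomp X (LinearMap.id : A →ₗ[R] A) i = LinearMap.id := by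
  ext x
  exact Ext.comp_mk₀_id x

lemma extPrecomp_comp {Y Z : Type u} [AddCommGroup Y] [Module R Y] [AddCommGroup Z] [Module R Z]
    (u : X →ₗ[R] Y) (v : Y →ₗ[R] Z) (i : ℕ) (x : ExtMod R Z A i) :
    extPrecomp u A i (extPrecomp v A i x) = extPrecomp (v ∘ₗ u) A i x := by
  rw [extPrecomp_apply, extPrecomp_apply, extPrecomp_apply, ModuleCat.ofHom_comp,
    ← Ext.mk₀_comp_mk₀, Ext.comp_assoc_of_second_deg_zero]

lemma extPrecomp_id (i : ℕ) (x : ExtMod R X A i) :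
    extPrecomp (LinearMap.id : X →ₗ[R] X) A i x = x :=
  Ext.mk₀_id_comp x

lemma extPrecomp_extPostcomp {Y : Type u} [AddCommGroup Y] [Module R Y] (u : X →ₗ[R] Y)
    (f : A →ₗ[R] B) (i : ℕ) :
    extPrecomp u B i ∘ₗ extPostcomp Y f i = extPostcomp X f i ∘ₗ extPrecomp u A i := by
  ext x
  rw [LinearMap.comp_apply, LinearMap.comp_apply, extPostcomp_apply, extPostcomp_apply,
    extPrecomp_apply, extPrecomp_apply, Ext.comp_assoc_of_third_deg_zero]

/-- Isomorphic coefficient modules have isomorphic `Ext`. -/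
noncomputable def extCongr (e : A ≃ₗ[R] B) (i : ℕ) : ExtMod R X A i ≃ₗ[R] ExtMod R X B i :=
  LinearEquiv.ofLinearMap (extPostcomp X e.toLinearMap i) (extPostcomp X e.symm.toLinearMap i)
    (by rw [extPostcomp_comp, LinearEquiv.comp_symm, extPostcomp_id])
    (by rw [extPostcomp_comp, LinearEquiv.symm_comp, extPostcomp_id])

/-- `Ext^0` is `Hom`. -/
noncomputable def extZeroEquiv (X A : Type u) [AddCommGroup X] [Module R X] [AddCommGroup A]
    [Module R A] : ExtMod R X A 0 ≃ₗ[R] (X →ₗ[R] A) :=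
  Ext.linearEquiv₀.trans ModuleCat.homLinearEquiv

lemma extZeroEquiv_symm_apply (φ : X →ₗ[R] A) :
    (extZeroEquiv X A).symm φ = Ext.mk₀ (ModuleCat.ofHom φ) := rfl

lemma extZeroEquiv_postcomp (f : A →ₗ[R] B) (x : ExtMod R X A 0) :
    extZeroEquiv X B (extPostcomp X f 0 x) = f ∘ₗ extZeroEquiv X A x := by
  obtain ⟨φ, rfl⟩ := (extZeroEquiv X A).symm.surjective x
  rw [LinearEquiv.apply_symm_apply, ← LinearEquiv.eq_symm_apply, extZeroEquiv_symm_apply,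
    extZeroEquiv_symm_apply, extPostcomp_apply, Ext.mk₀_comp_mk₀, ModuleCat.ofHom_comp]

lemma extZeroEquiv_precomp {Y : Type u} [AddCommGroup Y] [Module R Y] (u : X →ₗ[R] Y)
    (x : ExtMod R Y A 0) :
    extZeroEquiv X A (extPrecomp u A 0 x) = extZeroEquiv Y A x ∘ₗ u := by
  obtain ⟨φ, rfl⟩ := (extZeroEquiv Y A).symm.surjective x
  rw [LinearEquiv.apply_symm_apply, ← LinearEquiv.eq_symm_apply, extZeroEquiv_symm_apply,
    extZeroEquiv_symm_apply, extPrecomp_apply, Ext.mk₀_comp_mk₀, ModuleCat.ofHom_comp]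

lemma extMod_subsingleton_of_injective [Module.Injective R A] (i : ℕ) :
    Subsingleton (ExtMod R X A (i + 1)) :=
  have : CategoryTheory.Injective (ModuleCat.of R A) :=
    Module.injective_object_of_injective_module R A
  Ext.subsingleton_of_injective _ _ _

variable {f : A →ₗ[R] B} {g : B →ₗ[R] C}

section

variable (hf : Function.Injective f) (hfg : Function.Exact f g) (hg : Function.Surjective g)

lemma extδ_naturality {Y : Type u} [AddCommGroup Y] [Module R Y] (u : X →ₗ[R] Y) (i : ℕ) :
    extPrecomp u A (i + 1) ∘ₗ extδ Y hf hfg hg i = extδ X hf hfg hg i ∘ₗ extPrecomp u C i := by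
  ext x
  rw [LinearMap.comp_apply, LinearMap.comp_apply, extδ_apply, extδ_apply,
    extPrecomp_apply, extPrecomp_apply, Ext.comp_assoc _ _ _ (zero_add i) rfl (by omega)]

include hf hfg hg in
lemma ext_exact_middle (i : ℕ) :
    Function.Exact (extPostcomp X f i) (extPostcomp X g i) := by
  intro x
  constructor
  · intro hx
    exact Ext.covariant_sequence_exact₂ (ModuleCat.of R X) (sesComplex_shortExact hf hfg hg) x hx
  · rintro ⟨y, rfl⟩
    have h := congrArg (fun k : ExtMod R X A i →ₗ[R] ExtMod R X C i => k y)
      (extPostcomp_comp X f g i)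
    refine h.trans ?_
    rw [hfg.linearMap_comp_eq_zero]
    rw [extPostcomp_apply, ModuleCat.ofHom_zero, Ext.mk₀_zero, Ext.comp_zero]

lemma ext_exact_right (i : ℕ) :
    Function.Exact (extPostcomp X g i) (extδ X hf hfg hg i) := by
  intro x
  constructor
  · intro hx
    exact Ext.covariant_sequence_exact₃ (ModuleCat.of R X) (sesComplex_shortExact hf hfg hg) x
      rfl hx
  · rintro ⟨y, rfl⟩
    rw [extPostcomp_apply, extδ_apply, Ext.comp_assoc_of_second_deg_zero,
      (sesComplex_shortExact hf hfg hg).comp_extClass, Ext.comp_zero]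

lemma ext_exact_left (i : ℕ) :
    Function.Exact (extδ X hf hfg hg i) (extPostcomp X f (i + 1)) := by
  intro x
  constructor
  · intro hx
    exact Ext.covariant_sequence_exact₁ (ModuleCat.of R X) (sesComplex_shortExact hf hfg hg) x
      hx rfl
  · rintro ⟨y, rfl⟩
    rw [extPostcomp_apply, extδ_apply, Ext.comp_assoc_of_third_deg_zero,
      (sesComplex_shortExact hf hfg hg).extClass_comp, Ext.comp_zero]

lemma extδ_surjective [Subsingleton (ExtMod R X B (i + 1))] :
    Function.Surjective (extδ X hf hfg hg i) := fun x =>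
  (ext_exact_left X hf hfg hg i x).1 (Subsingleton.elim _ _)

lemma extδ_bijective [Subsingleton (ExtMod R X B i)] [Subsingleton (ExtMod R X B (i + 1))] :
    Function.Bijective (extδ X hf hfg hg i) := by
  refine ⟨(injective_iff_map_eq_zero _).2 fun x hx => ?_, extδ_surjective X hf hfg hg⟩
  obtain ⟨y, rfl⟩ := (ext_exact_right X hf hfg hg i x).1 hx
  rw [Subsingleton.elim y 0, map_zero]

include hf hfg hg in
lemma extPostcomp_bijective [Subsingleton (ExtMod R X A i)] [Subsingleton (ExtMod R X A (i + 1))] :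
    Function.Bijective (extPostcomp X g i) := by
  refine ⟨(injective_iff_map_eq_zero _).2 fun x hx => ?_, fun x =>
    (ext_exact_right X hf hfg hg i x).1 (Subsingleton.elim _ _)⟩
  obtain ⟨y, rfl⟩ := (ext_exact_middle X hf hfg hg i x).1 hx
  rw [Subsingleton.elim y 0, map_zero]

include hf hfg hg in
lemma ext_subsingleton_middle [Subsingleton (ExtMod R X A i)] [Subsingleton (ExtMod R X C i)] :
    Subsingleton (ExtMod R X B i) := by
  refine subsingleton_of_forall_eq 0 fun x => ?_
  obtain ⟨y, rfl⟩ := (ext_exact_middle X hf hfg hg i x).1 (Subsingleton.elim _ _)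
  rw [Subsingleton.elim y 0, map_zero]

end

end ExtLayer

/-! ### Exactness of directed limits -/

section DirectLimit

variable {R ι : Type*} [Semiring R] [Preorder ι] [DecidableEq ι] [Nonempty ι] [IsDirectedOrder ι]
  {G₁ G₂ G₃ : ι → Type*} [∀ i, AddCommMonoid (G₁ i)] [∀ i, Module R (G₁ i)]
  [∀ i, AddCommMonoid (G₂ i)] [∀ i, Module R (G₂ i)]
  [∀ i, AddCommMonoid (G₃ i)] [∀ i, Module R (G₃ i)]
  {f₁ : ∀ i j, i ≤ j → G₁ i →ₗ[R] G₁ j} {f₂ : ∀ i j, i ≤ j → G₂ i →ₗ[R] G₂ j}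
  {f₃ : ∀ i j, i ≤ j → G₃ i →ₗ[R] G₃ j}

lemma directLimit_map_surjective (g : ∀ i, G₁ i →ₗ[R] G₂ i)
    (hg : ∀ i j h, g j ∘ₗ f₁ i j h = f₂ i j h ∘ₗ g i) (hs : ∀ i, Function.Surjective (g i)) :
    Function.Surjective (Module.DirectLimit.map g hg) := by
  intro z
  obtain ⟨i, x, rfl⟩ := Module.DirectLimit.exists_of z
  obtain ⟨y, rfl⟩ := hs i x
  exact ⟨Module.DirectLimit.of R ι G₁ f₁ i y, Module.DirectLimit.map_apply_of g hg y⟩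

lemma directLimit_map_exact [DirectedSystem G₃ (f₃ · · ·)] (g : ∀ i, G₁ i →ₗ[R] G₂ i)
    (hg : ∀ i j h, g j ∘ₗ f₁ i j h = f₂ i j h ∘ₗ g i) (k : ∀ i, G₂ i →ₗ[R] G₃ i)
    (hk : ∀ i j h, k j ∘ₗ f₂ i j h = f₃ i j h ∘ₗ k i) (he : ∀ i, Function.Exact (g i) (k i)) :
    Function.Exact (Module.DirectLimit.map g hg) (Module.DirectLimit.map k hk) := by
  intro z
  constructor
  · intro hz
    obtain ⟨i, x, rfl⟩ := Module.DirectLimit.exists_of z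
    rw [Module.DirectLimit.map_apply_of] at hz
    obtain ⟨j, hij, hj⟩ := Module.DirectLimit.of.zero_exact hz
    have h0 : k j (f₂ i j hij x) = 0 := (LinearMap.congr_fun (hk i j hij) x).trans hj
    obtain ⟨y, hy⟩ := (he j _).1 h0
    refine ⟨Module.DirectLimit.of R ι G₁ f₁ j y, ?_⟩
    rw [Module.DirectLimit.map_apply_of, hy, Module.DirectLimit.of_f]
  · rintro ⟨y, rfl⟩
    obtain ⟨i, x, rfl⟩ := Module.DirectLimit.exists_of y
    rw [Module.DirectLimit.map_apply_of, Module.DirectLimit.map_apply_of,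
      (he i _).2 ⟨x, rfl⟩, map_zero]

end DirectLimit

/-! ### The torsion functor `Γ_I` -/

section Torsion

variable {R : Type u} [CommRing R] (I : Ideal R)

/-- The submodule `Γ_I(X)` of elements annihilated by a power of `I`. -/
def powTorsion (X : Type u) [AddCommGroup X] [Module R X] : Submodule R X where
  carrier := {x | ∃ k : ℕ, ∀ a ∈ I ^ k, a • x = 0}
  zero_mem' := ⟨0, fun a _ => smul_zero a⟩
  add_mem' := by
    rintro x y ⟨k, hk⟩ ⟨l, hl⟩
    refine ⟨max k l, fun a ha => ?_⟩
    rw [smul_add, hk a (Ideal.pow_le_pow_right (le_max_left k l) ha),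
      hl a (Ideal.pow_le_pow_right (le_max_right k l) ha), add_zero]
  smul_mem' := by
    rintro c x ⟨k, hk⟩
    exact ⟨k, fun a ha => by rw [smul_comm, hk a ha, smul_zero]⟩

variable {I}
variable {M : Type u} [AddCommGroup M] [Module R M]
  {A : Type u} [AddCommGroup A] [Module R A] {B : Type u} [AddCommGroup B] [Module R B]
  {C : Type u} [AddCommGroup C] [Module R C]

lemma map_mem_powTorsion (f : A →ₗ[R] B) {x : A} (hx : x ∈ powTorsion I A) :
    f x ∈ powTorsion I B := by
  obtain ⟨k, hk⟩ := hx
  exact ⟨k, fun a ha => by rw [← map_smul, hk a ha, map_zero]⟩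

variable (I) in
/-- `Γ_I` as a functor. -/
def powTorsionMap (f : A →ₗ[R] B) : powTorsion I A →ₗ[R] powTorsion I B :=
  f.restrict fun _ hx => map_mem_powTorsion f hx

@[simp] lemma coe_powTorsionMap (f : A →ₗ[R] B) (x : powTorsion I A) :
    (powTorsionMap I f x : B) = f x := rfl

lemma powTorsionMap_injective {f : A →ₗ[R] B} (hf : Function.Injective f) :
    Function.Injective (powTorsionMap I f) := fun _ _ h =>
  Subtype.ext (hf (congrArg Subtype.val h))

/-- Left exactness: as `f` is injective, a preimage of a torsion element is killed by the same power
of `I`. -/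
lemma powTorsionMap_exact {f : A →ₗ[R] B} {g : B →ₗ[R] C} (hf : Function.Injective f)
    (hfg : Function.Exact f g) : Function.Exact (powTorsionMap I f) (powTorsionMap I g) := by
  rintro ⟨x, k, hk⟩
  constructor
  · intro h
    obtain ⟨y, rfl⟩ := (hfg x).1 (congrArg Subtype.val h)
    refine ⟨⟨y, k, fun a ha => hf ?_⟩, rfl⟩
    rw [map_smul, hk a ha, map_zero]
  · rintro ⟨y, hy⟩
    rw [← hy]
    exact Subtype.ext ((hfg _).2 ⟨y, rfl⟩)

/-- A map from a finite module into an `I`-power torsion module is killed by one power of `I`. -/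
lemma exists_pow_smul_eq_zero [Module.Finite R M] (φ : M →ₗ[R] A)
    (hφ : ∀ m, φ m ∈ powTorsion I A) : ∃ k : ℕ, ∀ a ∈ I ^ k, ∀ m, a • φ m = 0 := by
  obtain ⟨s, hs⟩ := Module.Finite.fg_top (R := R) (M := M)
  choose k hk using hφ
  refine ⟨s.sup k, fun a ha m => ?_⟩
  have hm : m ∈ Submodule.span R (s : Set M) := hs ▸ Submodule.mem_top
  induction hm using Submodule.span_induction with
  | mem x hx => exact hk x a (Ideal.pow_le_pow_right (Finset.le_sup hx) ha)
  | zero => rw [map_zero, smul_zero]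
  | add x y _ _ hx hy => rw [map_add, smul_add, hx, hy, add_zero]
  | smul c x _ hx => rw [map_smul, smul_comm, hx, smul_zero]

/-- Over a Noetherian ring, `Γ_I` preserves injective modules. -/
instance powTorsion_injective [IsNoetherianRing R] [Module.Injective R A] :
    Module.Injective R (powTorsion I A) := by
  refine Module.Baer.injective fun J φ => ?_
  obtain ⟨k, hk⟩ := exists_pow_smul_eq_zero ((powTorsion I A).subtype ∘ₗ φ)
    fun m => (φ m).2
  -- Artin–Rees: `I ^ (k + l) ∩ J ⊆ I ^ k • J`, and `φ` kills the right-hand side by the choice of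
  -- `k`.
  obtain ⟨l, hl⟩ := Ideal.exists_pow_inf_eq_pow_smul I J
  have hker : ∀ x (hx : x ∈ J), x ∈ I ^ (k + l) → φ ⟨x, hx⟩ = 0 := by
    intro x hx hxI
    have h1 : x ∈ I ^ (k + l) • (⊤ : Ideal R) ⊓ J := ⟨by simpa using hxI, hx⟩
    rw [hl (k + l) (Nat.le_add_left l k), Nat.add_sub_cancel] at h1
    have h2 : x ∈ I ^ k • J := Submodule.smul_mono le_rfl inf_le_right h1
    have h3 : ∀ y ∈ I ^ k • J, ∃ hy : y ∈ J, φ ⟨y, hy⟩ = 0 := by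
      intro y hy
      induction hy using Submodule.smul_induction_on' with
      | smul a ha n hn =>
        refine ⟨J.smul_mem a hn, ?_⟩
        have : (⟨a • n, J.smul_mem a hn⟩ : J) = a • ⟨n, hn⟩ := rfl
        rw [this, map_smul]
        exact Subtype.ext (hk a ha ⟨n, hn⟩)
      | add y _ z _ hy hz =>
        obtain ⟨hyJ, hy⟩ := hy
        obtain ⟨hzJ, hz⟩ := hz
        refine ⟨J.add_mem hyJ hzJ, ?_⟩
        have : (⟨y + z, J.add_mem hyJ hzJ⟩ : J) = ⟨y, hyJ⟩ + ⟨z, hzJ⟩ := rfl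
        rw [this, map_add, hy, hz, add_zero]
    exact (h3 x h2).2
  -- `J / K` embeds in `R / I ^ (k + l)`, and `φ` factors through it. Extending to `R / I ^ (k + l)
  -- → A` instead of `R → A` forces all values to be killed by `I ^ (k + l)`, hence to lie in
  -- `Γ_I(A)`.
  let K : Submodule R J := LinearMap.ker ((Submodule.mkQ (I ^ (k + l) : Ideal R)) ∘ₗ J.subtype)
  have hK : K ≤ LinearMap.ker φ := by
    intro x hx
    exact hker x.1 x.2 ((Submodule.Quotient.mk_eq_zero _).1 hx)
  obtain ⟨ψ, hψ⟩ := Module.Injective.out (Q := A)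
    (K.liftQ ((Submodule.mkQ (I ^ (k + l) : Ideal R)) ∘ₗ J.subtype) le_rfl)
    (LinearMap.ker_eq_bot.1 (Submodule.ker_liftQ_eq_bot _ _ _ le_rfl))
    (K.liftQ ((powTorsion I A).subtype ∘ₗ φ) (hK.trans (LinearMap.ker_le_ker_comp _ _)))
  refine ⟨LinearMap.codRestrict _ (ψ ∘ₗ Submodule.mkQ (I ^ (k + l) : Ideal R)) fun r => ?_,
    fun x hx => Subtype.ext ?_⟩
  · refine ⟨k + l, fun a ha => ?_⟩
    rw [← map_smul, LinearMap.comp_apply, Submodule.mkQ_apply, (Submodule.Quotient.mk_eq_zero _).2, map_zero]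
    exact Ideal.mul_mem_right r _ ha
  · have := hψ (Submodule.Quotient.mk ⟨x, hx⟩)
    exact this

end Torsion

/-! ### Generalized local cohomology: connecting maps, dimension shifting, degree zero -/

section GenLocalCohomology

variable {R : Type u} [CommRing R] (I : Ideal R)
  (M : Type u) [AddCommGroup M] [Module R M]
  {A : Type u} [AddCommGroup A] [Module R A] {B : Type u} [AddCommGroup B] [Module R B]
  {C : Type u} [AddCommGroup C] [Module R C]

lemma factorPow_self (q : ℕ) : Submodule.factorPow I M (le_refl q) = LinearMap.id :=
  Submodule.linearMap_qext _ rfl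

lemma factorPow_comp_factorPow {i j k : ℕ} (h₁ : i ≤ j) (h₂ : j ≤ k) :
    Submodule.factorPow I M h₁ ∘ₗ Submodule.factorPow I M h₂ =
      Submodule.factorPow I M (h₁.trans h₂) :=
  Submodule.factor_comp _ _

instance genLocalCohomology_directedSystem (i : ℕ) :
    DirectedSystem (fun q : ℕ => ExtMod R (M ⧸ (I ^ q • ⊤ : Submodule R M)) A i)
      (fun _ _ h => extPrecomp (Submodule.factorPow I M h) A i) where
  map_self q x :=
    (congrArg (fun u => extPrecomp u A i x) (factorPow_self I M q)).trans (extPrecomp_id _ i x)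
  map_map _ _ _ h₁ h₂ x :=
    (extPrecomp_comp _ _ _ i x).trans
      (congrArg (fun u => extPrecomp u A i x) (factorPow_comp_factorPow I M h₁ h₂))

/-- The structure map of the direct limit defining `H^i_I(M, A)`. -/
noncomputable def genLCOf (A : Type u) [AddCommGroup A] [Module R A] (i q : ℕ) :
    ExtMod R (M ⧸ (I ^ q • ⊤ : Submodule R M)) A i →ₗ[R] genLocalCohomology I M A i :=
  Module.DirectLimit.of R ℕ (fun q : ℕ => ExtMod R (M ⧸ (I ^ q • ⊤ : Submodule R M)) A i)
    (fun _ _ h => extPrecomp (Submodule.factorPow I M h) A i) q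

lemma exists_genLCOf {i : ℕ} (z : genLocalCohomology I M A i) :
    ∃ q x, genLCOf I M A i q x = z :=
  Module.DirectLimit.exists_of z

/-- The functoriality of `H^i_I(M, -)`. -/
noncomputable def genLCMap (f : A →ₗ[R] B) (i : ℕ) :
    genLocalCohomology I M A i →ₗ[R] genLocalCohomology I M B i :=
  Module.DirectLimit.map (fun _ => extPostcomp _ f i)
    fun _ _ _ => (extPrecomp_extPostcomp _ _ f i).symm

lemma genLCMap_of (f : A →ₗ[R] B) (i q : ℕ)
    (x : ExtMod R (M ⧸ (I ^ q • ⊤ : Submodule R M)) A i) :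
    genLCMap I M f i (genLCOf I M A i q x) = genLCOf I M B i q (extPostcomp _ f i x) := by
  unfold genLCMap genLCOf
  rw [Module.DirectLimit.map_apply_of]

section

variable {f : A →ₗ[R] B} {g : B →ₗ[R] C} (hf : Function.Injective f) (hfg : Function.Exact f g)
  (hg : Function.Surjective g)

/-- The connecting map `H^i_I(M, C) → H^{i+1}_I(M, A)` of a short exact sequence. -/
noncomputable def genLCδ (i : ℕ) :
    genLocalCohomology I M C i →ₗ[R] genLocalCohomology I M A (i + 1) :=
  Module.DirectLimit.map (fun _ => extδ _ hf hfg hg i)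
    fun _ _ _ => (extδ_naturality _ hf hfg hg _ i).symm

lemma genLC_exact (i : ℕ) : Function.Exact (genLCMap I M g i) (genLCδ I M hf hfg hg i) :=
  directLimit_map_exact _ _ _ _ fun _ => ext_exact_right _ hf hfg hg i

lemma genLCδ_surjective [Module.Injective R B] (i : ℕ) :
    Function.Surjective (genLCδ I M hf hfg hg i) :=
  directLimit_map_surjective _ _ fun q => by
    have := extMod_subsingleton_of_injective (M ⧸ (I ^ q • ⊤ : Submodule R M)) (R := R) (A := B) i
    exact extδ_surjective (M ⧸ (I ^ q • ⊤ : Submodule R M)) (i := i) hf hfg hg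

/-- Dimension shifting along an embedding into an injective module. -/
noncomputable def genLCShift [Module.Injective R B] (i : ℕ) :
    genLocalCohomology I M C (i + 1) ≃ₗ[R] genLocalCohomology I M A (i + 2) :=
  Module.DirectLimit.congr
    (fun q => LinearEquiv.ofBijective (extδ _ hf hfg hg (i + 1))
      (by
      have := extMod_subsingleton_of_injective (M ⧸ (I ^ q • ⊤ : Submodule R M)) (R := R) (A := B) i
      have := extMod_subsingleton_of_injective (M ⧸ (I ^ q • ⊤ : Submodule R M)) (R := R) (A := B) (i + 1)
      exact extδ_bijective (M ⧸ (I ^ q • ⊤ : Submodule R M)) (i := i + 1) hf hfg hg))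
    fun _ _ _ => (extδ_naturality _ hf hfg hg _ (i + 1)).symm

end

/-- A map `M / I^q M → A` gives a map `M → Γ_I(A)`. -/
def homQuotToPowTorsion (A : Type u) [AddCommGroup A] [Module R A] (q : ℕ) :
    ((M ⧸ (I ^ q • ⊤ : Submodule R M)) →ₗ[R] A) →ₗ[R] (M →ₗ[R] powTorsion I A) where
  toFun φ := LinearMap.codRestrict _ (φ ∘ₗ Submodule.mkQ _) fun m =>
    ⟨q, fun a ha => by
      rw [← map_smul, LinearMap.comp_apply, Submodule.mkQ_apply,
        (Submodule.Quotient.mk_eq_zero _).2 (Submodule.smul_mem_smul ha Submodule.mem_top),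
        map_zero]⟩
  map_add' _ _ := rfl
  map_smul' _ _ := rfl

lemma homQuotToPowTorsion_factorPow {i j : ℕ} (h : i ≤ j)
    (φ : (M ⧸ (I ^ i • ⊤ : Submodule R M)) →ₗ[R] A) :
    homQuotToPowTorsion I M A j (φ ∘ₗ Submodule.factorPow I M h) =
      homQuotToPowTorsion I M A i φ :=
  LinearMap.ext fun m => Subtype.ext (congrArg φ (Submodule.factor_mk _ m))

/-- The natural map `H^0_I(M, A) → Hom_R(M, Γ_I(A))`. -/
noncomputable def genLCZeroHom (A : Type u) [AddCommGroup A] [Module R A] :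
    genLocalCohomology I M A 0 →ₗ[R] (M →ₗ[R] powTorsion I A) :=
  Module.DirectLimit.lift R ℕ _ _
    (fun q => homQuotToPowTorsion I M A q ∘ₗ (extZeroEquiv _ A).toLinearMap)
    fun i j hij x => by
      rw [LinearMap.comp_apply, LinearEquiv.coe_coe, extZeroEquiv_precomp,
        homQuotToPowTorsion_factorPow, LinearMap.comp_apply, LinearEquiv.coe_coe]

lemma genLCZeroHom_of (q : ℕ) (x : ExtMod R (M ⧸ (I ^ q • ⊤ : Submodule R M)) A 0) :
    genLCZeroHom I M A (genLCOf I M A 0 q x) =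
      homQuotToPowTorsion I M A q (extZeroEquiv _ A x) := by
  unfold genLCZeroHom genLCOf
  exact Module.DirectLimit.lift_of
    (fun q => homQuotToPowTorsion I M A q ∘ₗ (extZeroEquiv _ A).toLinearMap) _ x

/-- Each stage is injective because `M → M / I^q M` is onto. Surjectivity needs `M` finite: one
power of `I` then kills the whole image of a map `M → Γ_I(A)`. -/
lemma genLCZeroHom_bijective [Module.Finite R M] : Function.Bijective (genLCZeroHom I M A) := by
  constructor
  · refine Module.DirectLimit.lift_injective _ _ fun q => ?_
    refine Function.Injective.comp (g := homQuotToPowTorsion I M A q) (fun φ ψ h => ?_)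
      (extZeroEquiv (M ⧸ (I ^ q • ⊤ : Submodule R M)) A).injective
    refine Submodule.linearMap_qext _ (LinearMap.ext fun m => ?_)
    exact congrArg Subtype.val (LinearMap.congr_fun h m)
  · intro φ
    obtain ⟨k, hk⟩ := exists_pow_smul_eq_zero ((powTorsion I A).subtype ∘ₗ φ) fun m => (φ m).2
    have hle : (I ^ k • ⊤ : Submodule R M) ≤ LinearMap.ker ((powTorsion I A).subtype ∘ₗ φ) :=
      Submodule.smul_le.2 fun a ha m _ => by
        rw [LinearMap.mem_ker, map_smul]
        exact hk a ha m
    refine ⟨genLCOf I M A 0 k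
      ((extZeroEquiv _ A).symm (Submodule.liftQ _ _ hle)), ?_⟩
    rw [genLCZeroHom_of, LinearEquiv.apply_symm_apply]
    rfl

/-- `H^0_I(M, A) ≅ Hom_R(M, Γ_I(A))` for finite `M`. -/
noncomputable def genLCZeroEquiv (A : Type u) [AddCommGroup A] [Module R A] [Module.Finite R M] :
    genLocalCohomology I M A 0 ≃ₗ[R] (M →ₗ[R] powTorsion I A) :=
  LinearEquiv.ofBijective _ (genLCZeroHom_bijective I M)

lemma genLCZeroEquiv_map [Module.Finite R M] (f : A →ₗ[R] B) (x : genLocalCohomology I M A 0) :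
    genLCZeroEquiv I M B (genLCMap I M f 0 x) = powTorsionMap I f ∘ₗ genLCZeroEquiv I M A x := by
  obtain ⟨q, x, rfl⟩ := exists_genLCOf I M x
  refine (congrArg (genLCZeroHom I M B) (genLCMap_of I M f 0 q x)).trans ?_
  rw [genLCZeroHom_of, extZeroEquiv_postcomp]
  exact congrArg (powTorsionMap I f ∘ₗ ·) (genLCZeroHom_of I M q x).symm

/-- `H^0_I(A) ≅ Γ_I(A)`. -/
noncomputable def localCohomologyZeroEquiv (A : Type u) [AddCommGroup A] [Module R A] :
    localCohomology I A 0 ≃ₗ[R] powTorsion I A :=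
  (genLCZeroEquiv I R A).trans (LinearMap.ringLmapEquivSelf R R _)

end GenLocalCohomology

/-! ### From degree zero of `C` to degree one of `N` -/

section Step

variable {R : Type u} [CommRing R]

/-- Two surjections with the same kernel have isomorphic targets. -/
noncomputable def equivOfKerEq {X Y Z : Type*} [AddCommGroup X] [Module R X] [AddCommGroup Y]
    [Module R Y] [AddCommGroup Z] [Module R Z] (a : X →ₗ[R] Y) (b : X →ₗ[R] Z)
    (ha : Function.Surjective a) (hb : Function.Surjective b) (h : ∀ x, a x = 0 ↔ b x = 0) :
    Y ≃ₗ[R] Z :=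
  (a.quotKerEquivOfSurjective ha).symm.trans
    ((Submodule.quotEquivOfEq _ _ (Submodule.ext h)).trans (b.quotKerEquivOfSurjective hb))

lemma exists_injective_embedding (N : Type u) [AddCommGroup N] [Module R N] :
    ∃ (E : Type u) (_ : AddCommGroup E) (_ : Module R E) (f : N →ₗ[R] E),
      Module.Injective R E ∧ Function.Injective f := by
  obtain ⟨J⟩ := CategoryTheory.EnoughInjectives.presentation (ModuleCat.of R N)
  exact ⟨J.J, inferInstance, inferInstance, J.f.hom,
    (Module.injective_iff_injective_object R J.J).2 J.injective,
    (ModuleCat.mono_iff_injective J.f).1 J.mono⟩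

variable (I : Ideal R) (M : Type u) [AddCommGroup M] [Module R M] [Module.Finite R M]
  {N : Type u} [AddCommGroup N] [Module R N] {E : Type u} [AddCommGroup E] [Module R E]
  {C : Type u} [AddCommGroup C] [Module R C] [Module.Injective R E]
  {f : N →ₗ[R] E} {g : E →ₗ[R] C}
  (hf : Function.Injective f) (hfg : Function.Exact f g) (hg : Function.Surjective g)

/-- The connecting map `Hom(M, Γ_I(C)) → H^1_I(M, N)`. -/
noncomputable def homConnecting : (M →ₗ[R] powTorsion I C) →ₗ[R] genLocalCohomology I M N 1 :=
  genLCδ I M hf hfg hg 0 ∘ₗ (genLCZeroEquiv I M C).symm.toLinearMap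

lemma homConnecting_surjective : Function.Surjective (homConnecting I M hf hfg hg) :=
  (genLCδ_surjective I M hf hfg hg 0).comp (genLCZeroEquiv I M C).symm.surjective

-- Together with surjectivity of the connecting map, this presents `H^1_I(M, N)` as a cokernel of
-- Hom modules.
omit [Module.Injective R E] in
lemma homConnecting_eq_zero_iff (φ : M →ₗ[R] powTorsion I C) :
    homConnecting I M hf hfg hg φ = 0 ↔ ∃ ψ : M →ₗ[R] powTorsion I E,
      powTorsionMap I g ∘ₗ ψ = φ := by
  refine (genLC_exact I M hf hfg hg 0 ((genLCZeroEquiv I M C).symm φ)).trans ?_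
  constructor
  · rintro ⟨x, hx⟩
    exact ⟨genLCZeroEquiv I M E x, by
      rw [← genLCZeroEquiv_map, hx, LinearEquiv.apply_symm_apply]⟩
  · rintro ⟨ψ, rfl⟩
    refine ⟨(genLCZeroEquiv I M E).symm ψ, ?_⟩
    rw [LinearEquiv.eq_symm_apply, genLCZeroEquiv_map, LinearEquiv.apply_symm_apply]

/-- The connecting map `Γ_I(C) → H^1_I(N)`. -/
noncomputable def torsionConnecting : powTorsion I C →ₗ[R] localCohomology I N 1 :=
  homConnecting I R hf hfg hg ∘ₗ (LinearMap.ringLmapEquivSelf R R _).symm.toLinearMap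

lemma torsionConnecting_surjective : Function.Surjective (torsionConnecting I hf hfg hg) :=
  (homConnecting_surjective I R hf hfg hg).comp (LinearEquiv.surjective _)

omit [Module.Injective R E] in
lemma torsionConnecting_exact :
    Function.Exact (powTorsionMap I g) (torsionConnecting I hf hfg hg) := by
  intro x
  refine (homConnecting_eq_zero_iff I R hf hfg hg _).trans ?_
  constructor
  · rintro ⟨ψ, hψ⟩
    refine ⟨ψ 1, ?_⟩
    have := LinearMap.congr_fun hψ 1
    simpa using this
  · rintro ⟨y, rfl⟩
    refine ⟨(LinearMap.ringLmapEquivSelf R R _).symm y, LinearMap.ext_ring ?_⟩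
    simp

-- The nontrivial exactness in 0 → B → Γ_I(C) → H^1_I(N) → 0.
omit [Module.Injective R E] in
lemma torsionConnecting_exact_subtype :
    Function.Exact (LinearMap.range (powTorsionMap I g)).subtype
      (torsionConnecting I hf hfg hg) := fun x =>
  (torsionConnecting_exact I hf hfg hg x).trans
    ⟨fun h => ⟨⟨x, h⟩, rfl⟩, by rintro ⟨y, rfl⟩; exact y.2⟩

-- The nontrivial exactness in 0 → Γ_I(N) → Γ_I(E) → B → 0.
omit [Module.Injective R E] in
include hf hfg in
lemma powTorsionMap_exact_rangeRestrict :
    Function.Exact (powTorsionMap I f) (powTorsionMap I g).rangeRestrict := fun x =>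
  Iff.trans ⟨fun h => congrArg Subtype.val h, fun h => Subtype.ext h⟩
    (powTorsionMap_exact hf hfg x)

variable [IsNoetherianRing R]

/-- Dimension shifting for the range of `Γ_I(E) → Γ_I(C)`. -/
noncomputable def extBoundaryEquiv (i : ℕ) :
    ExtMod R M (LinearMap.range (powTorsionMap I g)) (i + 1) ≃ₗ[R]
      ExtMod R M (powTorsion I N) (i + 2) :=
  LinearEquiv.ofBijective (extδ M (powTorsionMap_injective hf)
    (powTorsionMap_exact_rangeRestrict I hf hfg) (LinearMap.surjective_rangeRestrict _) (i + 1))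
    (by
      have := extMod_subsingleton_of_injective M (R := R) (A := powTorsion I E) i
      have := extMod_subsingleton_of_injective M (R := R) (A := powTorsion I E) (i + 1)
      exact extδ_bijective M (i := i + 1) _ _ _)

omit [Module.Finite R M] in
include hf hfg hg in
lemma ext_powTorsion_subsingleton (i : ℕ) [Subsingleton (ExtMod R M (powTorsion I N) (i + 2))]
    [Subsingleton (ExtMod R M (localCohomology I N 1) (i + 1))] :
    Subsingleton (ExtMod R M (powTorsion I C) (i + 1)) := by
  have := (extBoundaryEquiv I M hf hfg i).toEquiv.subsingleton
  exact ext_subsingleton_middle M (i := i + 1) (Submodule.injective_subtype _)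
    (torsionConnecting_exact_subtype I hf hfg hg) (torsionConnecting_surjective I hf hfg hg)

/-- `Ext(M, Γ_I(C))` agrees with `Ext(M, H^1_I(N))` if two groups `Ext(M, Γ_I(N))` vanish. -/
noncomputable def extPowTorsionEquiv (i : ℕ)
    [Subsingleton (ExtMod R M (powTorsion I N) (i + 2))]
    [Subsingleton (ExtMod R M (powTorsion I N) (i + 3))] :
    ExtMod R M (powTorsion I C) (i + 1) ≃ₗ[R] ExtMod R M (localCohomology I N 1) (i + 1) :=
  LinearEquiv.ofBijective (extPostcomp M (torsionConnecting I hf hfg hg) (i + 1)) (by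
    have := (extBoundaryEquiv I M hf hfg i).toEquiv.subsingleton
    have := (extBoundaryEquiv I M hf hfg (i + 1)).toEquiv.subsingleton
    exact extPostcomp_bijective M (i := i + 1) (Submodule.injective_subtype _)
      (torsionConnecting_exact_subtype I hf hfg hg) (torsionConnecting_surjective I hf hfg hg))

-- Here `B` is all of `Γ_I(C)`, so the two short exact sequences merge into one.
omit [IsNoetherianRing R] [Module.Injective R E] in
include hf hfg hg in
lemma powTorsionMap_surjective [Subsingleton (localCohomology I N 1)] :
    Function.Surjective (powTorsionMap I g) := fun x =>
  (torsionConnecting_exact I hf hfg hg x).1 (Subsingleton.elim _ _)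

/-- Dimension shifting for `Γ_I` if `H^1_I(N)` vanishes. -/
noncomputable def extPowTorsionShift (i : ℕ) [Subsingleton (localCohomology I N 1)] :
    ExtMod R M (powTorsion I C) (i + 1) ≃ₗ[R] ExtMod R M (powTorsion I N) (i + 2) :=
  LinearEquiv.ofBijective (extδ M (powTorsionMap_injective hf)
    (powTorsionMap_exact hf hfg) (powTorsionMap_surjective I hf hfg hg) (i + 1))
    (by
      have := extMod_subsingleton_of_injective M (R := R) (A := powTorsion I E) i
      have := extMod_subsingleton_of_injective M (R := R) (A := powTorsion I E) (i + 1)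
      exact extδ_bijective M (i := i + 1) _ _ _)

/-- `H^1_I(M, N) ≅ Ext^1(M, Γ_I(N))` if `H^1_I(N)` vanishes. -/
noncomputable def genLCOneEquivExt [Subsingleton (localCohomology I N 1)] :
    genLocalCohomology I M N 1 ≃ₗ[R] ExtMod R M (powTorsion I N) 1 :=
  equivOfKerEq (homConnecting I M hf hfg hg)
    (extδ M (powTorsionMap_injective hf) (powTorsionMap_exact hf hfg)
      (powTorsionMap_surjective I hf hfg hg) 0 ∘ₗ (extZeroEquiv M _).symm.toLinearMap)
    (homConnecting_surjective I M hf hfg hg)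
    (by
      have := extMod_subsingleton_of_injective M (R := R) (A := powTorsion I E) 0
      rw [LinearMap.coe_comp]
      exact (extδ_surjective M (i := 0) (powTorsionMap_injective hf) (powTorsionMap_exact hf hfg)
        (powTorsionMap_surjective I hf hfg hg)).comp
        (extZeroEquiv M _).symm.surjective)
    fun φ => by
      rw [homConnecting_eq_zero_iff, LinearMap.comp_apply, LinearEquiv.coe_coe,
        ext_exact_right M (powTorsionMap_injective hf) (powTorsionMap_exact hf hfg)
          (powTorsionMap_surjective I hf hfg hg) 0]
      constructor
      · rintro ⟨ψ, rfl⟩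
        refine ⟨(extZeroEquiv M _).symm ψ, ?_⟩
        rw [LinearEquiv.eq_symm_apply, extZeroEquiv_postcomp, LinearEquiv.apply_symm_apply]
      · rintro ⟨x, hx⟩
        exact ⟨extZeroEquiv M _ x, by
          rw [← extZeroEquiv_postcomp, hx, LinearEquiv.apply_symm_apply]⟩

-- The obstruction to lifting a map `M → B` to `Γ_I(E)` lies in `Ext^1(M, Γ_I(N))`.
omit [Module.Finite R M] [Module.Injective R E] [IsNoetherianRing R] in
include hf hfg in
lemma exists_lift_of_range [Subsingleton (ExtMod R M (powTorsion I N) 1)]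
    (φ : M →ₗ[R] LinearMap.range (powTorsionMap I g)) :
    ∃ ψ : M →ₗ[R] powTorsion I E, (powTorsionMap I g).rangeRestrict ∘ₗ ψ = φ := by
  obtain ⟨x, hx⟩ := (ext_exact_right M (powTorsionMap_injective hf)
    (powTorsionMap_exact_rangeRestrict I hf hfg) (LinearMap.surjective_rangeRestrict _) 0
    ((extZeroEquiv M _).symm φ)).1 (Subsingleton.elim _ _)
  exact ⟨extZeroEquiv M _ x, by
    rw [← extZeroEquiv_postcomp, hx, LinearEquiv.apply_symm_apply]⟩

-- A map killed by `Γ_I(C) → H^1_I(N)` lands in `B`, and then lifts to `Γ_I(E)`.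
omit [Module.Injective R E] [IsNoetherianRing R] in
lemma homConnecting_eq_zero_iff_torsionConnecting
    [Subsingleton (ExtMod R M (powTorsion I N) 1)] (φ : M →ₗ[R] powTorsion I C) :
    homConnecting I M hf hfg hg φ = 0 ↔ torsionConnecting I hf hfg hg ∘ₗ φ = 0 := by
  rw [homConnecting_eq_zero_iff]
  constructor
  · rintro ⟨ψ, rfl⟩
    rw [← LinearMap.comp_assoc, (torsionConnecting_exact I hf hfg hg).linearMap_comp_eq_zero,
      LinearMap.zero_comp]
  · intro h
    obtain ⟨ψ, hψ⟩ := exists_lift_of_range I M hf hfg (LinearMap.codRestrict _ φ fun m =>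
      (torsionConnecting_exact I hf hfg hg _).1 (LinearMap.congr_fun h m))
    exact ⟨ψ, LinearMap.ext fun m => congrArg Subtype.val (LinearMap.congr_fun hψ m)⟩

omit [IsNoetherianRing R] in
include hf hfg hg in
lemma genLC_one_subsingleton [Subsingleton (ExtMod R M (powTorsion I N) 1)]
    [Subsingleton (M →ₗ[R] localCohomology I N 1)] :
    Subsingleton (genLocalCohomology I M N 1) := by
  refine subsingleton_of_forall_eq 0 fun x => ?_
  obtain ⟨φ, rfl⟩ := homConnecting_surjective I M hf hfg hg x
  exact (homConnecting_eq_zero_iff_torsionConnecting I M hf hfg hg φ).2 (Subsingleton.elim _ _)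

-- The obstruction lies in `Ext^1(M, B) ≅ Ext^2(M, Γ_I(N))`.
omit [Module.Finite R M] in
include hf hfg hg in
lemma exists_torsionConnecting_lift [Subsingleton (ExtMod R M (powTorsion I N) 2)]
    (φ : M →ₗ[R] localCohomology I N 1) :
    ∃ ψ : M →ₗ[R] powTorsion I C, torsionConnecting I hf hfg hg ∘ₗ ψ = φ := by
  have := (extBoundaryEquiv I M hf hfg 0).toEquiv.subsingleton
  obtain ⟨x, hx⟩ := (ext_exact_right M (Submodule.injective_subtype _)
    (torsionConnecting_exact_subtype I hf hfg hg) (torsionConnecting_surjective I hf hfg hg) 0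
    ((extZeroEquiv M _).symm φ)).1 (Subsingleton.elim _ _)
  exact ⟨extZeroEquiv M _ x, by
    rw [← extZeroEquiv_postcomp, hx, LinearEquiv.apply_symm_apply]⟩

/-- `H^1_I(M, N) ≅ Hom(M, H^1_I(N))` if `Ext^1(M, Γ_I(N))` and `Ext^2(M, Γ_I(N))` vanish. -/
noncomputable def genLCOneEquivHom [Subsingleton (ExtMod R M (powTorsion I N) 1)]
    [Subsingleton (ExtMod R M (powTorsion I N) 2)] :
    genLocalCohomology I M N 1 ≃ₗ[R] (M →ₗ[R] localCohomology I N 1) :=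
  equivOfKerEq (homConnecting I M hf hfg hg)
    (LinearMap.llcomp R M _ _ (torsionConnecting I hf hfg hg))
    (homConnecting_surjective I M hf hfg hg)
    (exists_torsionConnecting_lift I M hf hfg hg)
    (homConnecting_eq_zero_iff_torsionConnecting I M hf hfg hg)

end Step

/-! ### The three inductions on degree -/

section Induction

variable {R : Type u} [CommRing R] (I : Ideal R)
  (M : Type u) [AddCommGroup M] [Module R M]

/-- `Ext(M, H^0_I(N)) ≅ Ext(M, Γ_I(N))`. -/
noncomputable def extLocalCohomologyZeroEquiv (N : Type u) [AddCommGroup N] [Module R N] (i : ℕ) :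
    ExtMod R M (localCohomology I N 0) i ≃ₗ[R] ExtMod R M (powTorsion I N) i :=
  extCongr M (localCohomologyZeroEquiv I N) i

lemma extMod_subsingleton_coeff (X : Type u) [AddCommGroup X] [Module R X] [Subsingleton X]
    (i : ℕ) : Subsingleton (ExtMod R M X i) := by
  refine subsingleton_of_forall_eq 0 fun x => ?_
  have h : (LinearMap.id : X →ₗ[R] X) = 0 := LinearMap.ext fun _ => Subsingleton.elim _ _
  have h2 := LinearMap.congr_fun (extPostcomp_id M (A := X) (R := R) i) x
  rw [h, extPostcomp_apply, ModuleCat.ofHom_zero, CategoryTheory.Abelian.Ext.mk₀_zero,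
    CategoryTheory.Abelian.Ext.comp_zero] at h2
  exact h2.symm

variable [Module.Finite R M]

/-- `H^0_I(M, N) ≅ Hom(M, H^0_I(N))`. -/
noncomputable def genLCZeroEquivHom (N : Type u) [AddCommGroup N] [Module R N] :
    genLocalCohomology I M N 0 ≃ₗ[R] (M →ₗ[R] localCohomology I N 0) :=
  (genLCZeroEquiv I M N).trans (LinearEquiv.congrRight (localCohomologyZeroEquiv I N).symm)

variable [IsNoetherianRing R]

/-- If every `Ext^p(M, H^q_I(N))` with `p + q = n` vanishes, so does `H^n_I(M, N)`. -/
theorem genLocalCohomology_subsingleton (n : ℕ) : ∀ (N : Type u) [AddCommGroup N] [Module R N],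
    (∀ p q, p + q = n → Subsingleton (ExtMod R M (localCohomology I N q) p)) →
      Subsingleton (genLocalCohomology I M N n) := by
  induction n with
  | zero =>
    intro N _ _ h
    have := h 0 0 rfl
    exact ((genLCZeroEquivHom I M N).trans (extZeroEquiv M _).symm).toEquiv.subsingleton
  | succ n ih =>
    intro N _ _ h
    obtain ⟨E, _, _, f, hE, hf⟩ := exists_injective_embedding (R := R) N
    have hfg := LinearMap.exact_map_mkQ_range f
    have hg := Submodule.mkQ_surjective (LinearMap.range f)
    have h0 := h (n + 1) 0 rfl
    have h0' := (extLocalCohomologyZeroEquiv I M N (n + 1)).symm.toEquiv.subsingleton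
    have h1 := h n 1 rfl
    -- The shift only reaches degrees at least two of `N`, so total degree one is handled directly.
    cases n with
    | zero =>
      have := (extZeroEquiv (R := R) M (localCohomology I N 1)).symm.toEquiv.subsingleton
      exact genLC_one_subsingleton I M hf hfg hg
    | succ n =>
      -- The one term for `C` not obtained by shifting, `Ext^{n+1}(M, Γ_I(C))`, is controlled by the
      -- terms `(n + 2, 0)` and `(n + 1, 1)` of `N`.
      have h2 := ext_powTorsion_subsingleton I M hf hfg hg n
      have := ih (E ⧸ LinearMap.range f) fun p q hpq => by
        cases q with
        | zero =>
          obtain rfl : p = n + 1 := hpq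
          exact (extLocalCohomologyZeroEquiv I M _ (n + 1)).toEquiv.subsingleton
        | succ q =>
          have := h p (q + 2) (by omega)
          exact (extCongr M (genLCShift I R hf hfg hg q) p).toEquiv.subsingleton
      exact (genLCShift I M hf hfg hg n).symm.toEquiv.subsingleton

/-- If `H^q_I(N)` vanishes for all `q > 0`, then `H^n_I(M, N) ≅ Ext^n(M, H^0_I(N))`. -/
theorem nonempty_genLocalCohomology_equiv_ext (n : ℕ) :
    ∀ (N : Type u) [AddCommGroup N] [Module R N],
      (∀ q, Subsingleton (localCohomology I N (q + 1))) →
      Nonempty (ExtMod R M (localCohomology I N 0) n ≃ₗ[R] genLocalCohomology I M N n) := by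
  induction n with
  | zero =>
    intro N _ _ _
    exact ⟨(extZeroEquiv M _).trans (genLCZeroEquivHom I M N).symm⟩
  | succ n ih =>
    intro N _ _ h
    obtain ⟨E, _, _, f, hE, hf⟩ := exists_injective_embedding (R := R) N
    have hfg := LinearMap.exact_map_mkQ_range f
    have hg := Submodule.mkQ_surjective (LinearMap.range f)
    have h1 := h 0
    cases n with
    | zero =>
      exact ⟨(extLocalCohomologyZeroEquiv I M N 1).trans (genLCOneEquivExt I M hf hfg hg).symm⟩
    | succ n =>
      obtain ⟨e⟩ := ih (E ⧸ LinearMap.range f) fun q => by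
        have := h (q + 1)
        exact (genLCShift I R hf hfg hg q).toEquiv.subsingleton
      exact ⟨(extLocalCohomologyZeroEquiv I M N (n + 2)).trans
        ((extPowTorsionShift I M hf hfg hg n).symm.trans
        ((extLocalCohomologyZeroEquiv I M _ (n + 1)).symm.trans
        (e.trans (genLCShift I M hf hfg hg n))))⟩

/-- If `H^q_I(N)` vanishes for `q > c` and `Ext^p(M, H^q_I(N))` vanishes for `p > h`, then
`Ext^h(M, H^c_I(N)) ≅ H^{c+h}_I(M, N)`. -/
theorem nonempty_ext_equiv_genLocalCohomology (h c : ℕ) :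
    ∀ (N : Type u) [AddCommGroup N] [Module R N],
      (∀ q, c < q → Subsingleton (localCohomology I N q)) →
      (∀ p q, h < p → Subsingleton (ExtMod R M (localCohomology I N q) p)) →
      Nonempty (ExtMod R M (localCohomology I N c) h ≃ₗ[R] genLocalCohomology I M N (h + c)) := by
  induction c with
  | zero =>
    intro N _ _ hc _
    exact nonempty_genLocalCohomology_equiv_ext I M h N fun q => hc _ q.succ_pos
  | succ c ih =>
    intro N _ _ hc hh
    obtain ⟨E, _, _, f, hE, hf⟩ := exists_injective_embedding (R := R) N
    have hfg := LinearMap.exact_map_mkQ_range f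
    have hg := Submodule.mkQ_surjective (LinearMap.range f)
    have hΓ : ∀ p, h < p → Subsingleton (ExtMod R M (powTorsion I N) p) := fun p hp =>
      have := hh p 0 hp
      (extLocalCohomologyZeroEquiv I M N p).symm.toEquiv.subsingleton
    have hC : ∀ q, c < q → Subsingleton (localCohomology I (E ⧸ LinearMap.range f) q) := by
      intro q hq
      obtain ⟨q, rfl⟩ := Nat.exists_eq_succ_of_ne_zero (Nat.ne_zero_of_lt hq)
      have := hc (q + 2) (by omega)
      exact (genLCShift I R hf hfg hg q).toEquiv.subsingleton
    have hE' : ∀ p q, h < p →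
        Subsingleton (ExtMod R M (localCohomology I (E ⧸ LinearMap.range f) q) p) := by
      intro p q hp
      cases q with
      | zero =>
        obtain ⟨p, rfl⟩ := Nat.exists_eq_succ_of_ne_zero (Nat.ne_zero_of_lt hp)
        have := hΓ (p + 2) (by omega)
        have := hh (p + 1) 1 hp
        have := ext_powTorsion_subsingleton I M hf hfg hg p
        exact (extLocalCohomologyZeroEquiv I M _ (p + 1)).toEquiv.subsingleton
      | succ q =>
        have := hh p (q + 2) hp
        exact (extCongr M (genLCShift I R hf hfg hg q) p).toEquiv.subsingleton
    obtain ⟨e⟩ := ih (E ⧸ LinearMap.range f) hC hE'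
    cases c with
    | succ c =>
      exact ⟨(extCongr M (genLCShift I R hf hfg hg c).symm h).trans
        (e.trans (genLCShift I M hf hfg hg (h + c)))⟩
    -- `H^1_I(N)` is only the quotient of `Γ_I(C)` by `B`. For positive `h`, `B` has no Ext in
    -- degrees `h` and `h + 1`, so the quotient map induces an isomorphism on `Ext^h`. For `h = 0`
    -- this fails, as `Hom(M, B)` may be nonzero.
    | zero =>
      have := hΓ (h + 1) (by omega)
      have := hΓ (h + 2) (by omega)
      cases h with
      | zero =>
        exact ⟨(extZeroEquiv M _).trans (genLCOneEquivHom I M hf hfg hg).symm⟩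
      | succ h =>
        exact ⟨(extPowTorsionEquiv I M hf hfg hg h).symm.trans
          ((extLocalCohomologyZeroEquiv I M _ (h + 1)).symm.trans
          (e.trans (genLCShift I M hf hfg hg h)))⟩

/-- If `Ext^p(M, Γ_I(N))` vanishes for `p > 0` and `H^q_I(N)` for `0 < q < t`, then
`H^t_I(M, N) ≅ Hom(M, H^t_I(N))`. -/
theorem nonempty_genLocalCohomology_equiv_hom_of_ext (t : ℕ) :
    ∀ (N : Type u) [AddCommGroup N] [Module R N],
      (∀ p, Subsingleton (ExtMod R M (powTorsion I N) (p + 1))) →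
      (∀ q, 0 < q → q < t + 1 → Subsingleton (localCohomology I N q)) →
      Nonempty (genLocalCohomology I M N (t + 1) ≃ₗ[R] (M →ₗ[R] localCohomology I N (t + 1))) := by
  induction t with
  | zero =>
    intro N _ _ hΓ _
    obtain ⟨E, _, _, f, hE, hf⟩ := exists_injective_embedding (R := R) N
    have := hΓ 0
    have := hΓ 1
    exact ⟨genLCOneEquivHom I M hf (LinearMap.exact_map_mkQ_range f)
      (Submodule.mkQ_surjective (LinearMap.range f))⟩
  | succ t ih =>
    intro N _ _ hΓ hq
    obtain ⟨E, _, _, f, hE, hf⟩ := exists_injective_embedding (R := R) N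
    have hfg := LinearMap.exact_map_mkQ_range f
    have hg := Submodule.mkQ_surjective (LinearMap.range f)
    have h1 := hq 1 (by omega) (by omega)
    -- Vanishing of `Γ_I(N)` would not pass to `C`, but vanishing of its higher Ext modules does;
    -- hence the weaker induction hypothesis.
    obtain ⟨e⟩ := ih (E ⧸ LinearMap.range f)
      (fun p => by
        have := hΓ (p + 1)
        exact (extPowTorsionShift I M hf hfg hg p).toEquiv.subsingleton)
      fun q hq0 hqt => by
        obtain ⟨q, rfl⟩ := Nat.exists_eq_succ_of_ne_zero hq0.ne'
        have := hq (q + 2) (by omega) (by omega)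
        exact (genLCShift I R hf hfg hg q).toEquiv.subsingleton
    exact ⟨(genLCShift I M hf hfg hg t).symm.trans
      (e.trans (LinearEquiv.congrRight (genLCShift I R hf hfg hg t)))⟩

/-- If `H^q_I(N)` vanishes for `q < t`, then `H^t_I(M, N) ≅ Hom(M, H^t_I(N))`. -/
theorem nonempty_genLocalCohomology_equiv_hom (N : Type u) [AddCommGroup N] [Module R N] (t : ℕ)
    (h : ∀ q < t, Subsingleton (localCohomology I N q)) :
    Nonempty (genLocalCohomology I M N t ≃ₗ[R] (M →ₗ[R] localCohomology I N t)) := by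
  cases t with
  | zero => exact ⟨genLCZeroEquivHom I M N⟩
  | succ t =>
    have := h 0 t.succ_pos
    have := (localCohomologyZeroEquiv I N).symm.toEquiv.subsingleton
    exact nonempty_genLocalCohomology_equiv_hom_of_ext I M t N
      (fun p => extMod_subsingleton_coeff M _ _) fun q _ hq => h q hq

end Induction

/-! ### From suprema and infima to nonvanishing degrees -/

section Bounds

variable {R : Type u} [CommRing R] {I : Ideal R} {M : Type u} [AddCommGroup M] [Module R M]
  {N : Type u} [AddCommGroup N] [Module R N]

lemma le_pairCd {i : ℕ} (h : Nontrivial (genLocalCohomology I M N i)) :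
    ((i : ℕ∞) : WithBot ℕ∞) ≤ pairCd I M N :=
  le_iSup₂ (f := fun (i : ℕ) (_ : Nontrivial (genLocalCohomology I M N i)) =>
    ((i : ℕ∞) : WithBot ℕ∞)) i h

lemma le_cd {i : ℕ} (h : Nontrivial (localCohomology I N i)) :
    ((i : ℕ∞) : WithBot ℕ∞) ≤ cd I N :=
  le_pairCd h

lemma pairDepth_le {i : ℕ} (h : Nontrivial (genLocalCohomology I M N i)) :
    pairDepth I M N ≤ (i : ℕ∞) :=
  iInf₂_le (f := fun (i : ℕ) (_ : Nontrivial (genLocalCohomology I M N i)) => (i : ℕ∞)) i h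

lemma depth_le {i : ℕ} (h : Nontrivial (localCohomology I N i)) : depth I N ≤ (i : ℕ∞) :=
  pairDepth_le h

lemma le_hInv {p q : ℕ} (h : Nontrivial (ExtMod R M (localCohomology I N q) p)) :
    ((p : ℕ∞) : WithBot ℕ∞) ≤ hInv I M N :=
  (le_iSup₂ (f := fun (i : ℕ) (_ : Nontrivial (ExtMod R M (localCohomology I N q) i)) =>
    ((i : ℕ∞) : WithBot ℕ∞)) p h).trans (le_iSup (fun q => extSup R M (localCohomology I N q)) q)

/-- A nonzero `H^n_I(M, N)` is witnessed by a nonzero `Ext^p(M, H^q_I(N))` with `p + q = n`. -/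
lemma exists_nontrivial_ext [IsNoetherianRing R] [Module.Finite R M] {n : ℕ}
    (h : Nontrivial (genLocalCohomology I M N n)) :
    ∃ p q, p + q = n ∧ Nontrivial (ExtMod R M (localCohomology I N q) p) ∧
      Nontrivial (localCohomology I N q) := by
  by_contra! hcon
  refine not_subsingleton_iff_nontrivial.2 h
    (genLocalCohomology_subsingleton I M n N fun p q hpq => ?_)
  by_contra hs
  have := hcon p q hpq (not_subsingleton_iff_nontrivial.1 hs)
  exact hs (extMod_subsingleton_coeff M _ _)

end Bounds

end GenLC

/-! ### Assembly -/

theorem theorem2p4 {R : Type u} [CommRing R] [IsNoetherianRing R] (I : Ideal R) (hI : I ≠ ⊤)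
    (M : Type u) [AddCommGroup M] [Module R M] [Module.Finite R M]
    (N : Type u) [AddCommGroup N] [Module R N] :
    -- the three inequalities; the middle one needs a nonvanishing `H^i_I(M, N)`
    (GenLC.depth I N ≤ GenLC.pairDepth I M N ∧
      ((∃ i : ℕ, Nontrivial (GenLC.genLocalCohomology I M N i)) →
        (GenLC.pairDepth I M N : WithBot ℕ∞) ≤ GenLC.pairCd I M N) ∧
      GenLC.pairCd I M N ≤ GenLC.cd I N + GenLC.hInv I M N) ∧
    -- the isomorphism in top degree, whenever `cd_I N` and `h_I(M, N)` are natural numbers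
    (∀ c h : ℕ, GenLC.cd I N = ((c : ℕ∞) : WithBot ℕ∞) →
      GenLC.hInv I M N = ((h : ℕ∞) : WithBot ℕ∞) →
      Nonempty (GenLC.ExtMod R M (GenLC.localCohomology I N c) h ≃ₗ[R]
        GenLC.genLocalCohomology I M N (c + h))) ∧
    -- the isomorphism in lowest degree, whenever `depth_I N` is a natural number
    (∀ t : ℕ, GenLC.depth I N = (t : ℕ∞) →
      (GenLC.depth I N = 0 ∨
        max 1 (GenLC.hInv I M N) ≤ (GenLC.depth I N : WithBot ℕ∞)) →
      Nonempty (GenLC.genLocalCohomology I M N t ≃ₗ[R]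
        (M →ₗ[R] GenLC.localCohomology I N t))) := by
  refine ⟨⟨?_, ?_, ?_⟩, ?_, ?_⟩
  · refine le_iInf₂ fun n hn => ?_
    obtain ⟨p, q, rfl, -, hq⟩ := GenLC.exists_nontrivial_ext hn
    exact (GenLC.depth_le hq).trans (by exact_mod_cast Nat.le_add_left q p)
  · rintro ⟨i, hi⟩
    exact (WithBot.coe_le_coe.2 (GenLC.pairDepth_le hi)).trans (GenLC.le_pairCd hi)
  -- Each nonvanishing degree `n = p + q` bounds both summands below by naturals, so the convention
  -- for `-∞` matters only when the left side is already `⊥`.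
  · refine iSup₂_le fun n hn => ?_
    obtain ⟨p, q, rfl, hp, hq⟩ := GenLC.exists_nontrivial_ext hn
    rw [add_comm p q, Nat.cast_add, WithBot.coe_add]
    exact add_le_add (GenLC.le_cd hq) (GenLC.le_hInv hp)
  · intro c h hc hh
    rw [add_comm c h]
    refine GenLC.nonempty_ext_equiv_genLocalCohomology I M h c N (fun q hq => ?_)
      fun p q hp => ?_
    · by_contra hs
      have := GenLC.le_cd (not_subsingleton_iff_nontrivial.1 hs)
      rw [hc, WithBot.coe_le_coe, Nat.cast_le] at this
      omega
    · by_contra hs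
      have := GenLC.le_hInv (not_subsingleton_iff_nontrivial.1 hs)
      rw [hh, WithBot.coe_le_coe, Nat.cast_le] at this
      omega
  · intro t ht _
    refine GenLC.nonempty_genLocalCohomology_equiv_hom I M N t fun q hq => ?_
    by_contra hs
    have := GenLC.depth_le (not_subsingleton_iff_nontrivial.1 hs)
    rw [ht, Nat.cast_le] at this
    omega
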